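/- Let $\lambda$ be an infinite regular cardinal and let $\mathcal{C}$ be a locally $\lambda$-presentable additive category. Call a morphism $f : A \to B$ of $\mathcal{C}$ \emph{$\lambda$-pure} if for every morphism $g : X \to Y$ between $\lambda$-presentable objects of $\mathcal{C}$ and every $u : X \to A$ such that $fu$ factors through $g$, the morphism $u$ itself factors through $g$. Call a full subcategory $\mathcal{D} \subseteq \mathcal{C}$ \emph{$\lambda$-definable} if it is closed under (small) products, under $\lambda$-directed colimits, and under $\lambda$-pure subobjects (if $f : A \to B$ is $\lambda$-pure and $B \in \mathcal{D}$, then $A \in \mathcal{D}$). Let $\mathrm{fun}_\lambda\,\mathcal{C}$ be the category of functors $\mathcal{C} \to \mathbf{Ab}$ which preserve $\lambda$-directed colimits and (small) products. A full subcategory $\mathcal{D} \subseteq \mathcal{C}$ is $\lambda$-definable if and only if there is a full subcategory $\mathcal{F} \subseteq \mathrm{fun}_\lambda\,\mathcal{C}$ such that \[ \mathcal{D} = \{\, C \in \mathcal{C} : FC = 0 \text{ for all } F \in \mathcal{F} \,\}. \] -/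

import Mathlib

universe w v u

open CategoryTheory CategoryTheory.Limits

namespace LambdaDefinable

/-- A morphism `f : A ⟶ B` is `κ`-pure if, for every morphism `g : X ⟶ Y` between `κ`-presentable
objects and every `a : X ⟶ A`, if `a ≫ f` factors through `g`, then so does `a`. -/
def IsPure {C : Type u} [Category.{v} C] (κ : Cardinal.{w}) [Fact κ.IsRegular]
    {A B : C} (f : A ⟶ B) : Prop :=
  ∀ ⦃X Y : C⦄ (g : X ⟶ Y), IsCardinalPresentable X κ → IsCardinalPresentable Y κ →
    ∀ a : X ⟶ A, (∃ b : Y ⟶ B, g ≫ b = a ≫ f) → ∃ c : Y ⟶ A, g ≫ c = a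

/-- A full subcategory `D` of `C` (given by its class of objects) is `κ`-definable if it is closed
under products, `κ`-directed colimits and `κ`-pure subobjects in `C`. For a partially ordered set
`J`, `IsCardinalFiltered J κ` says that every family of fewer than `κ` elements of `J` has an
upper bound. -/
structure IsDefinable {C : Type u} [Category.{v} C] (κ : Cardinal.{w}) [Fact κ.IsRegular]
    (D : ObjectProperty C) : Prop where
  closed_products (ι : Type w) : D.IsClosedUnderLimitsOfShape (Discrete ι)
  closed_directed_colimits (J : Type w) [PartialOrder J] [IsCardinalFiltered J κ] :
    D.IsClosedUnderColimitsOfShape J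
  closed_pure_subobjects ⦃A B : C⦄ (f : A ⟶ B) : IsPure κ f → D B → D A

/-- The class of functors `C ⥤ Ab` which preserve `κ`-directed colimits and products. -/
structure IsFun {C : Type u} [Category.{v} C] (κ : Cardinal.{w}) [Fact κ.IsRegular]
    (F : C ⥤ AddCommGrpCat.{w}) : Prop where
  preserves_directed_colimits (J : Type w) [PartialOrder J] [IsCardinalFiltered J κ] :
    PreservesColimitsOfShape J F
  preserves_products (ι : Type w) : PreservesLimitsOfShape (Discrete ι) F

/-- The category `fun_κ C` of functors `C ⥤ Ab` which preserve `κ`-directed colimits and products,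
as a full subcategory of the category of all functors. -/
abbrev FunCat (C : Type u) [Category.{v} C] (κ : Cardinal.{w}) [Fact κ.IsRegular] :=
  ObjectProperty.FullSubcategory
    (fun F : C ⥤ AddCommGrpCat.{w} => IsFun κ F)

end LambdaDefinable

/-!
A `κ`-definable class `D` is the class of all objects that are injective with respect to every
morphism between `κ`-presentable objects for which all objects of `D` are injective. To see that
such an object `A` lies in `D`, write `A` as a `κ`-directed colimit of `κ`-presentable objects, and
suppose that `a : X ⟶ A` does not factor through `g : X ⟶ Y`, with `X` and `Y` `κ`-presentable.
Once `a` lifts to a stage `P` of the colimit, `A` is not injective with respect to the pushout of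
`g` to `P`, so some object of `D` is not injective either. This gives a morphism from `P` to an
object of `D` that detects the non-factorization. The cofree diagram on these objects of `D`
consists of products, hence it lies in `D`, and so does its colimit; the induced morphism from `A`
to the colimit detects that `a` does not factor through `g`. Letting `(g, a)` run through a small
set, the product of these morphisms is a `κ`-pure morphism from `A` to an object of `D`.

Additivity turns injectivity into vanishing: `A` is injective with respect to `g : X ⟶ Y` if and
only if `coker (Hom(Y, A) ⟶ Hom(X, A))` is zero. This cokernel is a functor in `fun_κ C` because
cokernels commute with colimits and products of abelian groups are exact. Conversely, a functor
preserving `κ`-directed colimits sends `κ`-pure morphisms to monomorphisms, so its vanishing is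
inherited by `κ`-pure subobjects.
-/

namespace LambdaDefinable

section Injectivity

variable {C : Type u} [Category.{v} C]

/-- The class of objects `A` that are injective with respect to `g : X ⟶ Y`, i.e. such that every
morphism `X ⟶ A` extends along `g`. -/
def injectivityClass {X Y : C} (g : X ⟶ Y) : ObjectProperty C :=
  fun A => ∀ a : X ⟶ A, ∃ b : Y ⟶ A, g ≫ b = a

lemma injectivityClass_pushout_inr_iff {X Y P : C} (g : X ⟶ Y) (a : X ⟶ P) [HasPushout g a]
    (B : C) :
    injectivityClass (pushout.inr g a) B ↔ ∀ u : P ⟶ B, ∃ b : Y ⟶ B, g ≫ b = a ≫ u :=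
  forall_congr' fun u =>
    ⟨fun ⟨b, hb⟩ => ⟨pushout.inl g a ≫ b, by rw [pushout.condition_assoc, hb]⟩,
      fun ⟨b, hb⟩ => ⟨pushout.desc b u hb, pushout.inr_desc b u hb⟩⟩

/-- The `κ`-injectivity hull of `D`: the objects that are injective with respect to every morphism
between `κ`-presentable objects for which all objects of `D` are injective. -/
def injectivityHull (κ : Cardinal.{w}) [Fact κ.IsRegular] (D : ObjectProperty C) :
    ObjectProperty C :=
  fun A => ∀ ⦃X Y : C⦄ (g : X ⟶ Y), IsCardinalPresentable X κ → IsCardinalPresentable Y κ →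
    D ≤ injectivityClass g → injectivityClass g A

end Injectivity

section Presentable

variable {C : Type u} [Category.{v} C] (κ : Cardinal.{w}) [Fact κ.IsRegular]

lemma isCardinalPresentable_pushout [LocallySmall.{w} C] {X Y Z : C} (f : X ⟶ Y) (g : X ⟶ Z)
    [HasPushout f g] [IsCardinalPresentable X κ] [IsCardinalPresentable Y κ]
    [IsCardinalPresentable Z κ] :
    IsCardinalPresentable (pushout f g) κ := by
  have (k : WalkingSpan) : IsCardinalPresentable ((span f g).obj k) κ := by
    rcases k with _ | _ | _ <;> assumption
  exact isCardinalPresentable_of_isColimit _ (colimit.isColimit (span f g)) κ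
    (hasCardinalLT_of_finite _ _ (Cardinal.IsRegular.aleph0_le Fact.out))

variable {κ} in
lemma exists_factor_stage_of_isColimit {J : Type w} [SmallCategory J] [IsCardinalFiltered J κ]
    {T : J ⥤ C} {c : Cocone T} (hc : IsColimit c) {X Y : C} [IsCardinalPresentable X κ]
    [IsCardinalPresentable Y κ] (g : X ⟶ Y) {i : J} (a : X ⟶ T.obj i)
    (h : ∃ b : Y ⟶ c.pt, g ≫ b = a ≫ c.ι.app i) :
    ∃ (k : J) (s : i ⟶ k) (b : Y ⟶ T.obj k), g ≫ b = a ≫ T.map s := by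
  obtain ⟨b, hb⟩ := h
  obtain ⟨j, b, rfl⟩ := IsCardinalPresentable.exists_hom_of_isColimit κ hc b
  obtain ⟨k, s, t, hst⟩ := IsCardinalPresentable.exists_eq_of_isColimit κ hc a (g ≫ b)
    (by rw [← hb, Category.assoc])
  exact ⟨k, s, b ≫ T.map t, by rw [hst, Category.assoc]⟩

lemma exists_directed_presentation [IsCardinalLocallyPresentable C κ] (A : C) :
    ∃ (J : Type w) (_ : PartialOrder J) (_ : IsCardinalFiltered J κ),
      Nonempty ((isCardinalPresentable C κ).ColimitOfShape J A) := by
  obtain ⟨J, _, _, ⟨p⟩⟩ :=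
    (isCardinalFilteredGenerator_isCardinalPresentable C κ).exists_colimitsOfShape A
  obtain ⟨α, _, _, G, _⟩ := IsCardinalFiltered.exists_cardinal_directed J κ
  exact ⟨α, inferInstance, inferInstance, ⟨p.reindex G⟩⟩

lemma hasPushouts_of_isCardinalLocallyPresentable [IsCardinalLocallyPresentable C κ] :
    HasPushouts C :=
  have := hasColimitsOfSizeShrink.{0, 0, w, w} C
  inferInstance

variable (C) in
lemma exists_small_family_isCardinalPresentable [HasCardinalFilteredGenerator C κ] :
    ∃ (ι : Type w) (N : ι → C), (∀ i, IsCardinalPresentable (N i) κ) ∧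
      ∀ X : C, IsCardinalPresentable X κ → ∃ i, Nonempty (X ≅ N i) := by
  obtain ⟨Q, _, hQ, hQ'⟩ :=
    ObjectProperty.EssentiallySmall.exists_small_le.{w} (isCardinalPresentable C κ)
  let N (i : Shrink.{w} (Subtype Q)) : C := ((equivShrink _).symm i).1
  refine ⟨_, N, fun i => hQ _ ((equivShrink _).symm i).2, fun X hX => ?_⟩
  obtain ⟨Y, hY, ⟨e⟩⟩ := hQ' X hX
  exact ⟨equivShrink _ ⟨Y, hY⟩, ⟨e ≪≫ eqToIso (by simp [N])⟩⟩

variable {κ} in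
lemma isPure_of_forall_small_family {ι : Type*} {N : ι → C} {A B : C} {f : A ⟶ B}
    (hN : ∀ X : C, IsCardinalPresentable X κ → ∃ i, Nonempty (X ≅ N i))
    (hf : ∀ (i j : ι) (g : N i ⟶ N j) (a : N i ⟶ A), (∃ b, g ≫ b = a ≫ f) → ∃ c, g ≫ c = a) :
    IsPure κ f := by
  rintro X Y g hX hY a ⟨b, hb⟩
  obtain ⟨i, ⟨e⟩⟩ := hN X hX
  obtain ⟨j, ⟨e'⟩⟩ := hN Y hY
  obtain ⟨c, hc⟩ := hf i j (e.inv ≫ g ≫ e'.hom) (e.inv ≫ a) ⟨e'.inv ≫ b, by simp [hb]⟩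
  exact ⟨e'.hom ≫ c, by simpa using hc⟩

lemma hasLimits_of_isCardinalLocallyPresentable (C : Type u) [Category.{w} C]
    [IsCardinalLocallyPresentable C κ] : HasLimits C := by
  let A : SmallModel.{w} (isCardinalPresentable C κ).FullSubcategory ⥤ C :=
    (equivSmallModel.{w} _).inverse ⋙ (isCardinalPresentable C κ).ι
  let L := uliftYoneda.{w}.leftKanExtension A
  let : Reflective (Presheaf.restrictedULiftYoneda.{w} A) :=
    { L := L
      adj := Presheaf.uliftYonedaAdjunction.{w} L (uliftYoneda.{w}.leftKanExtensionUnit A) }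
  exact hasLimits_of_reflective (Presheaf.restrictedULiftYoneda.{w} A)

end Presentable

lemma exists_natTrans_forall_exists_factor {C : Type u} [Category.{w} C] [HasProducts.{w} C]
    {D : ObjectProperty C} (hD : ∀ ι : Type w, D.IsClosedUnderLimitsOfShape (Discrete ι))
    {J : Type w} [SmallCategory J] (K : J ⥤ C) {B : J → C} (hB : ∀ j, D (B j))
    (u : ∀ j, K.obj j ⟶ B j) :
    ∃ (T : J ⥤ C) (φ : K ⟶ T), (∀ j, D (T.obj j)) ∧
      ∀ j, ∃ ε : T.obj j ⟶ B j, φ.app j ≫ ε = u j := by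
  -- `∏ᶜ E` is the cofree diagram on the family `B`.
  let E (i : J) : J ⥤ C := (evaluationRightAdjoint C i).obj (B i)
  let v (i : J) : K ⟶ E i := (evaluationAdjunctionLeft C i).homEquiv K (B i) (u i)
  refine ⟨∏ᶜ E, Pi.lift v, fun j => ?_, fun j => ?_⟩
  · exact (D.inverseImage ((evaluation J C).obj j)).prop_pi E fun i => D.prop_pi _ fun _ => hB i
  · refine ⟨(Pi.π E j).app j ≫ (evaluationAdjunctionLeft C j).counit.app (B j), ?_⟩
    rw [← NatTrans.comp_app_assoc, Pi.lift_π]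
    rw [← evaluation_obj_map, ← Adjunction.homEquiv_counit, Equiv.symm_apply_apply]

section InjectivityHull

variable {C : Type u} [Category.{w} C] {κ : Cardinal.{w}} [Fact κ.IsRegular]
  [IsCardinalLocallyPresentable C κ] {D : ObjectProperty C} {A : C}

lemma injectivityHull.exists_hom_not_factor (hA : injectivityHull κ D A) {X Y P : C}
    [IsCardinalPresentable X κ] [IsCardinalPresentable Y κ] [IsCardinalPresentable P κ]
    (g : X ⟶ Y) (a : X ⟶ P) (x : P ⟶ A) (h : ¬ ∃ b : Y ⟶ A, g ≫ b = a ≫ x) :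
    ∃ (B : C) (_ : D B) (u : P ⟶ B), ¬ ∃ b : Y ⟶ B, g ≫ b = a ≫ u := by
  have := hasPushouts_of_isCardinalLocallyPresentable (C := C) κ
  by_contra! hD
  exact h ((injectivityClass_pushout_inr_iff g a A).1
    (hA _ inferInstance (isCardinalPresentable_pushout κ g a) fun B hB =>
      (injectivityClass_pushout_inr_iff g a B).2 (hD B hB)) x)

lemma IsDefinable.exists_hom_not_factor (hD : IsDefinable κ D) (hA : injectivityHull κ D A)
    {X Y : C} [IsCardinalPresentable X κ] [IsCardinalPresentable Y κ] (g : X ⟶ Y) (a : X ⟶ A)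
    (ha : ¬ ∃ b : Y ⟶ A, g ≫ b = a) :
    ∃ (B : C) (_ : D B) (h : A ⟶ B), ¬ ∃ b : Y ⟶ B, g ≫ b = a ≫ h := by
  have := hasLimits_of_isCardinalLocallyPresentable κ C
  obtain ⟨J, _, _, ⟨p⟩⟩ := exists_directed_presentation κ A
  have := isFiltered_of_isCardinalFiltered J κ
  have hp (i : J) : IsCardinalPresentable (p.diag.obj i) κ := p.prop_diag_obj i
  obtain ⟨i₀, a₀, rfl⟩ := IsCardinalPresentable.exists_hom_of_isColimit κ p.isColimit a
  have stage (i : J) : ∃ (B : C) (_ : D B) (u : p.diag.obj i ⟶ B),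
      ∀ s : i₀ ⟶ i, ¬ ∃ b : Y ⟶ B, g ≫ b = (a₀ ≫ p.diag.map s) ≫ u := by
    by_cases hi : Nonempty (i₀ ⟶ i)
    · obtain ⟨s⟩ := hi
      obtain ⟨B, hB, u, hu⟩ := hA.exists_hom_not_factor g (a₀ ≫ p.diag.map s)
        (p.ι.app i) (by rwa [Category.assoc, p.w])
      exact ⟨B, hB, u, fun t => Subsingleton.elim s t ▸ hu⟩
    · have := hD.closed_products PEmpty
      exact ⟨_, D.prop_pi PEmpty.elim (fun j => j.elim), Pi.lift fun j => j.elim,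
        fun s => (hi ⟨s⟩).elim⟩
  choose B hB u hu using stage
  obtain ⟨T, φ, hT, hφ⟩ := exists_natTrans_forall_exists_factor hD.closed_products p.diag hB u
  let c := (Cocone.precompose φ).obj (colimit.cocone T)
  have hc : p.ι.app i₀ ≫ p.isColimit.desc c = φ.app i₀ ≫ colimit.ι T i₀ := p.isColimit.fac c i₀
  have := hD.closed_directed_colimits J
  refine ⟨colimit T, D.prop_colimit T hT, p.isColimit.desc c, fun h => ?_⟩
  rw [Category.assoc, hc, ← Category.assoc] at h
  obtain ⟨k, s, b, hb⟩ := exists_factor_stage_of_isColimit (κ := κ) (colimit.isColimit T) g _ h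
  obtain ⟨ε, hε⟩ := hφ k
  refine hu k s ⟨b ≫ ε, ?_⟩
  rw [reassoc_of% hb, ← φ.naturality_assoc, hε, Category.assoc]

lemma IsDefinable.injectivityHull_le (hD : IsDefinable κ D) : injectivityHull κ D ≤ D := by
  intro A hA
  have := hasLimits_of_isCardinalLocallyPresentable κ C
  obtain ⟨ι, N, hN, hN'⟩ := exists_small_family_isCardinalPresentable C κ
  let I := Σ i j : ι, { q : (N i ⟶ N j) × (N i ⟶ A) // ¬ ∃ b, q.1 ≫ b = q.2 }
  choose B hB h hh using fun q : I => hD.exists_hom_not_factor hA q.2.2.1.1 q.2.2.1.2 q.2.2.2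
  have := hD.closed_products I
  refine hD.closed_pure_subobjects (Pi.lift h) ?_ (D.prop_pi B hB)
  refine isPure_of_forall_small_family hN' fun i j g a ⟨b, hb⟩ => ?_
  by_contra hga
  exact hh ⟨i, j, (g, a), hga⟩ ⟨b ≫ Pi.π B _, by rw [reassoc_of% hb, Pi.lift_π]⟩

end InjectivityHull

section Accessible

variable {C : Type u} [Category.{v} C] {κ : Cardinal.{w}} [Fact κ.IsRegular]

lemma isCardinalAccessible_of_preservesColimitsOfShape_directed {E : Type*} [Category* E]
    {F : C ⥤ E} (hF : ∀ (J : Type w) [PartialOrder J] [IsCardinalFiltered J κ],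
      PreservesColimitsOfShape J F) :
    F.IsCardinalAccessible κ where
  preservesColimitOfShape J _ _ := by
    obtain ⟨α, _, _, G, _⟩ := IsCardinalFiltered.exists_cardinal_directed J κ
    have := hF α
    exact Functor.Final.preservesColimitsOfShape_of_final G F

lemma IsFun.isCardinalAccessible {F : C ⥤ AddCommGrpCat.{w}} (hF : IsFun κ F) :
    F.IsCardinalAccessible κ :=
  isCardinalAccessible_of_preservesColimitsOfShape_directed hF.preserves_directed_colimits

lemma isCardinalAccessible_of_preservesFilteredColimits {E : Type*} [Category* E] (F : C ⥤ E)
    [PreservesFilteredColimitsOfSize.{w, w} F] : F.IsCardinalAccessible κ where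
  preservesColimitOfShape J _ _ :=
    have := isFiltered_of_isCardinalFiltered J κ
    inferInstance

lemma IsPure.map_injective [IsCardinalLocallyPresentable C κ] {A B : C} {f : A ⟶ B}
    (hf : IsPure κ f) (F : C ⥤ Type w) [F.IsCardinalAccessible κ] :
    Function.Injective (F.map f) := by
  intro x y hxy
  obtain ⟨J, _, _, ⟨p⟩⟩ := exists_directed_presentation κ A
  obtain ⟨J', _, _, ⟨q⟩⟩ := exists_directed_presentation κ B
  have := isFiltered_of_isCardinalFiltered J κ
  have := isFiltered_of_isCardinalFiltered J' κ
  have := F.preservesColimitsOfShape_of_isCardinalAccessible κ J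
  have := F.preservesColimitsOfShape_of_isCardinalAccessible κ J'
  have hp := isColimitOfPreserves F p.isColimit
  obtain ⟨i, x, y, rfl, rfl⟩ := Types.FilteredColimit.jointly_surjective_of_isColimit₂ hp x y
  have hi : IsCardinalPresentable (p.diag.obj i) κ := p.prop_diag_obj i
  obtain ⟨j, g, hg⟩ :=
    IsCardinalPresentable.exists_hom_of_isColimit κ q.isColimit (p.ι.app i ≫ f)
  have hgf (z : F.obj (p.diag.obj i)) :
      F.map (q.ι.app j) (F.map g z) = F.map f (F.map (p.ι.app i) z) := by
    simp only [← Functor.map_comp_apply, hg]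
  obtain ⟨k, t, ht⟩ := (Types.FilteredColimit.isColimit_eq_iff'
    (isColimitOfPreserves F q.isColimit) (F.map g x) (F.map g y)).1
      ((hgf x).trans (hxy.trans (hgf y).symm))
  obtain ⟨c, hc⟩ := hf (g ≫ q.diag.map t) hi (q.prop_diag_obj k) (p.ι.app i)
    ⟨q.ι.app k, by rw [← hg, Category.assoc, q.w]⟩
  replace hc (z : F.obj (p.diag.obj i)) :
      F.map (p.ι.app i) z = F.map c (F.map (q.diag.map t) (F.map g z)) := by
    simp only [← Functor.map_comp_apply, ← hc, Category.assoc]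
  exact (hc x).trans ((congrArg (F.map c) ht).trans (hc y).symm)

end Accessible

section VanishingClass

variable {C : Type u} [Category.{v} C] {κ : Cardinal.{w}} [Fact κ.IsRegular]

lemma IsDefinable.forall {ι : Sort*} {D : ι → ObjectProperty C}
    (hD : ∀ i, IsDefinable κ (D i)) : IsDefinable κ (fun X => ∀ i, D i X) where
  closed_products ι := ⟨fun _ ⟨p⟩ i =>
    have := (hD i).closed_products ι
    (D i).prop_of_isLimit p.isLimit fun j => p.prop_diag_obj j i⟩
  closed_directed_colimits J _ _ := ⟨fun _ ⟨p⟩ i =>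
    have := (hD i).closed_directed_colimits J
    (D i).prop_of_isColimit p.isColimit fun j => p.prop_diag_obj j i⟩
  closed_pure_subobjects _ _ f hf hB i := (hD i).closed_pure_subobjects f hf (hB i)

lemma IsFun.isDefinable_isZero [IsCardinalLocallyPresentable C κ] {F : C ⥤ AddCommGrpCat.{w}}
    (hF : IsFun κ F) : IsDefinable κ (fun X : C => IsZero (F.obj X)) where
  closed_products ι := ⟨by
    rintro X ⟨p⟩
    have := hF.preserves_products ι
    exact IsLimit.isZero_pt (isLimitOfPreserves F p.isLimit) (Functor.isZero _ p.prop_diag_obj)⟩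
  closed_directed_colimits J _ _ := ⟨by
    rintro X ⟨p⟩
    have := hF.preserves_directed_colimits J
    exact IsColimit.isZero_pt (isColimitOfPreserves F p.isColimit)
      (Functor.isZero _ p.prop_diag_obj)⟩
  closed_pure_subobjects A B f hf hB := by
    have := hF.isCardinalAccessible
    have : (forget AddCommGrpCat.{w}).IsCardinalAccessible κ :=
      isCardinalAccessible_of_preservesFilteredColimits _
    have hF := hf.map_injective (F ⋙ forget AddCommGrpCat)
    rw [AddCommGrpCat.isZero_iff_subsingleton] at hB ⊢
    exact hF.subsingleton

end VanishingClass

section ColimitsOfFunctors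

variable {C E : Type*} [Category* C] [Category* E] (J J' : Type*) [Category* J] [Category* J']

instance isClosedUnderColimitsOfShape_preservesColimitsOfShape [HasColimitsOfShape J' E] :
    ObjectProperty.IsClosedUnderColimitsOfShape
      (ObjectProperty.preservesColimitsOfShape J : ObjectProperty (C ⥤ E)) J' where
  colimitsOfShape_le := by
    rintro Q ⟨p⟩
    have := p.prop_diag_obj
    have : PreservesColimitsOfShape J p.diag.flip := ⟨fun {K} => ⟨fun {c} hc =>
      ⟨evaluationJointlyReflectsColimits _ fun k => isColimitOfPreserves (p.diag.obj k) hc⟩⟩⟩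
    exact preservesColimitsOfShape_of_natIso
      (p.isColimit.coconePointUniqueUpToIso (colimit.isColimit p.diag) ≪≫
        colimitIsoFlipCompColim p.diag).symm

instance isClosedUnderColimitsOfShape_preservesLimitsOfShape [HasLimitsOfShape J C]
    [HasLimitsOfShape J E] [HasColimitsOfShape J' E]
    [PreservesColimitsOfShape J' (lim : (J ⥤ E) ⥤ E)] :
    ObjectProperty.IsClosedUnderColimitsOfShape
      (ObjectProperty.preservesLimitsOfShape J : ObjectProperty (C ⥤ E)) J' where
  colimitsOfShape_le := by
    rintro Q ⟨p⟩
    have := p.prop_diag_obj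
    refine ⟨fun {K} => ?_⟩
    let post : (evaluation C E).obj (limit K) ⟶ (Functor.whiskeringLeft J C E).obj K ⋙ lim :=
      { app := fun F => limit.post K F }
    have (j : J') : IsIso ((Functor.whiskerLeft p.diag post).app j) :=
      inferInstanceAs (IsIso (limit.post K (p.diag.obj j)))
    have : IsIso (Functor.whiskerLeft p.diag post) := NatIso.isIso_of_isIso_app _
    have : IsIso (limit.post K Q) :=
      isIso_app_coconePt_of_preservesColimit p.diag post _ p.isColimit
    exact preservesLimit_of_isIso_post Q K

end ColimitsOfFunctors

section CokernelFunctor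

lemma isZero_cokernel_obj_iff {C E : Type*} [Category* C] [Category* E] [Preadditive E]
    [HasCoequalizers E] {F G : C ⥤ E} (α : F ⟶ G) (A : C) :
    IsZero ((cokernel α).obj A) ↔ Epi (α.app A) :=
  (PreservesCokernel.iso ((evaluation C E).obj A) α).isZero_iff.trans
    (Preadditive.epi_iff_isZero_cokernel (α.app A)).symm

lemma IsFun.cokernel {C : Type u} [Category.{v} C] [HasProducts.{w} C] {κ : Cardinal.{w}}
    [Fact κ.IsRegular] {F G : C ⥤ AddCommGrpCat.{w}} (hF : IsFun κ F) (hG : IsFun κ G)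
    (α : F ⟶ G) : IsFun κ (cokernel α) where
  preserves_directed_colimits J _ _ :=
    (ObjectProperty.preservesColimitsOfShape J).prop_colimit (parallelPair α 0) <| by
      rintro (_ | _)
      exacts [hF.preserves_directed_colimits J, hG.preserves_directed_colimits J]
  preserves_products ι :=
    (ObjectProperty.preservesLimitsOfShape (Discrete ι)).prop_colimit (parallelPair α 0) <| by
      rintro (_ | _)
      exacts [hF.preserves_products ι, hG.preserves_products ι]

variable {C : Type u} [Category.{w} C] [Preadditive C] {κ : Cardinal.{w}} [Fact κ.IsRegular]
  {X Y : C}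

lemma isFun_preadditiveCoyoneda_obj [IsCardinalPresentable X κ] :
    IsFun κ (preadditiveCoyoneda.obj (.op X)) where
  preserves_directed_colimits J _ _ := by
    have := isFiltered_of_isCardinalFiltered J κ
    have : PreservesColimitsOfShape J (preadditiveCoyoneda.obj (.op X) ⋙ forget _) :=
      preservesColimitsOfShape_of_isCardinalPresentable X κ J
    have : ReflectsColimitsOfShape J (forget AddCommGrpCat.{w}) :=
      reflectsColimitsOfShape_of_reflectsIsomorphisms
    exact preservesColimitsOfShape_of_reflects_of_preserves _ (forget _)
  preserves_products _ := inferInstance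

/-- The functor `A ↦ coker (Hom(Y, A) ⟶ Hom(X, A))`, which vanishes exactly at the objects that
are injective with respect to `g : X ⟶ Y`. -/
noncomputable def cokernelFunctor (g : X ⟶ Y) : C ⥤ AddCommGrpCat.{w} :=
  cokernel (preadditiveCoyoneda.map g.op)

lemma isZero_cokernelFunctor_obj_iff (g : X ⟶ Y) (A : C) :
    IsZero ((cokernelFunctor g).obj A) ↔ injectivityClass g A :=
  (isZero_cokernel_obj_iff _ A).trans (AddCommGrpCat.epi_iff_surjective _)

lemma isFun_cokernelFunctor [HasProducts.{w} C] [IsCardinalPresentable X κ]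
    [IsCardinalPresentable Y κ] (g : X ⟶ Y) : IsFun κ (cokernelFunctor g) :=
  isFun_preadditiveCoyoneda_obj.cokernel isFun_preadditiveCoyoneda_obj _

end CokernelFunctor

end LambdaDefinable

theorem mainTheorem5 {C : Type u} [Category.{w} C] [Preadditive C] [HasFiniteBiproducts C]
    (κ : Cardinal.{w}) [Fact κ.IsRegular] [IsCardinalLocallyPresentable C κ]
    (D : ObjectProperty C) :
    LambdaDefinable.IsDefinable κ D ↔
      ∃ 𝓕 : ObjectProperty (LambdaDefinable.FunCat C κ),
        ∀ X : C, D X ↔ ∀ F : LambdaDefinable.FunCat C κ, 𝓕 F → IsZero (F.obj.obj X) := by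
  constructor
  · intro hD
    have := LambdaDefinable.hasLimits_of_isCardinalLocallyPresentable κ C
    refine ⟨fun F => ∀ B, D B → IsZero (F.obj.obj B),
      fun A => ⟨fun hA F hF => hF A hA, fun hA => hD.injectivityHull_le A ?_⟩⟩
    intro X Y g hX hY hg
    rw [← LambdaDefinable.isZero_cokernelFunctor_obj_iff]
    exact hA ⟨LambdaDefinable.cokernelFunctor g, LambdaDefinable.isFun_cokernelFunctor g⟩
      fun B hB => (LambdaDefinable.isZero_cokernelFunctor_obj_iff g B).2 (hg B hB)
  · rintro ⟨𝓕, h𝓕⟩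
    obtain rfl : D = _ := funext fun X => propext (h𝓕 X)
    exact .forall fun F => .forall fun _ => F.property.isDefinable_isZero
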